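/- Let $n\ge 2$ and let $(M,J)$ be an almost complex manifold of real dimension $2n$: $M$ is a smooth (Hausdorff, second countable) manifold and $J$ is a smooth $(1,1)$ tensor field on $M$ with $J^2=-\mathrm{Id}$. For a smooth real function $\rho$ on an open set $U\subset M$ put $d^c_J\rho(v):=-d\rho(Jv)$ and $\mathcal L_J\rho(p,v):=dd^c_J\rho(p)(v,J(p)v)$; the function $\rho$ is strictly $J$-plurisubharmonic on $U$ if $\mathcal L_J\rho(p,v)>0$ for all $p\in U$ and all $0\ne v\in T_pM$. A domain (non-empty connected open set) $D\subset M$ is called a strongly $J$-pseudoconvex region if there are an open neighbourhood $U$ of $\overline D$ and a smooth function $\rho:U\to\mathbb R$, strictly $J$-plurisubharmonic on $U$, such that $D=\{p\in U:\rho(p)<0\}$ and $d\rho\neq 0$ at every point of $\partial D$. Proposition. If $D\subset M$ is a strongly $J$-pseudoconvex region and $\overline D$ is compact, then the boundary $\partial D$ is connected (and non-empty). -/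

import Mathlib

open scoped Manifold ContDiff Topology
open Bundle

noncomputable section

/-- A smooth almost complex structure on a smooth real manifold `M` of dimension `2 * n`: a smooth
`(1,1)` tensor field `J` (a smooth section of the bundle of endomorphisms of the tangent spaces)
with `J ∘ J = -id`. -/
structure AlmostComplexStructure (n : ℕ) (M : Type*) [TopologicalSpace M]
    [ChartedSpace (EuclideanSpace ℝ (Fin (2 * n))) M] [IsManifold (𝓡 (2 * n)) ∞ M] where
  /-- The endomorphism of each tangent space. -/
  toFun : ∀ p : M, TangentSpace (𝓡 (2 * n)) p →L[ℝ] TangentSpace (𝓡 (2 * n)) p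
  sq_eq_neg : ∀ (p : M) (v : TangentSpace (𝓡 (2 * n)) p), toFun p (toFun p v) = -v
  smooth : ContMDiff (𝓡 (2 * n))
    ((𝓡 (2 * n)).prod
      𝓘(ℝ, EuclideanSpace ℝ (Fin (2 * n)) →L[ℝ] EuclideanSpace ℝ (Fin (2 * n)))) ∞
    (fun p : M ↦ TotalSpace.mk' (EuclideanSpace ℝ (Fin (2 * n)) →L[ℝ]
      EuclideanSpace ℝ (Fin (2 * n)))
      (E := fun x : M ↦ TangentSpace (𝓡 (2 * n)) x →L[ℝ] TangentSpace (𝓡 (2 * n)) x)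
      p (toFun p))

namespace OneForm

variable {n : ℕ} {M : Type*} [TopologicalSpace M]
  [ChartedSpace (EuclideanSpace ℝ (Fin (2 * n))) M]

/-- The local expression of a one-form `α` on `M` in the preferred chart `φ` at `p`: the pull-back
`(φ⁻¹)^* α`, a one-form on the coordinate space (only its values on `φ.target` matter). -/
def inChart (α : ∀ q : M, TangentSpace (𝓡 (2 * n)) q →L[ℝ] ℝ) (p : M)
    (y : EuclideanSpace ℝ (Fin (2 * n))) : EuclideanSpace ℝ (Fin (2 * n)) →L[ℝ] ℝ :=
  (α ((extChartAt (𝓡 (2 * n)) p).symm y)).comp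
    (mfderiv 𝓘(ℝ, EuclideanSpace ℝ (Fin (2 * n))) (𝓡 (2 * n))
      (extChartAt (𝓡 (2 * n)) p).symm y)

/-- The exterior derivative `dα` at `p` of a one-form `α` on `M`, evaluated on `v w : T_p M`:
`(dα)_p (v, w) = d((φ⁻¹)^* α)_{φ p} (dφ_p v, dφ_p w)` where `φ` is the preferred chart at `p`.
The normalization is `dα (X, Y) = X (α Y) - Y (α X) - α [X, Y]`. -/
def extDerivAt (α : ∀ q : M, TangentSpace (𝓡 (2 * n)) q →L[ℝ] ℝ) (p : M)
    (v w : TangentSpace (𝓡 (2 * n)) p) : ℝ :=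
  extDeriv
    (fun y ↦ ContinuousAlternatingMap.ofSubsingleton ℝ (EuclideanSpace ℝ (Fin (2 * n))) ℝ
      (0 : Fin 1) (inChart α p y))
    (extChartAt (𝓡 (2 * n)) p p)
    ![mfderiv (𝓡 (2 * n)) 𝓘(ℝ, EuclideanSpace ℝ (Fin (2 * n))) (extChartAt (𝓡 (2 * n)) p) p v,
      mfderiv (𝓡 (2 * n)) 𝓘(ℝ, EuclideanSpace ℝ (Fin (2 * n))) (extChartAt (𝓡 (2 * n)) p) p w]

end OneForm

namespace AlmostComplexStructure

variable {n : ℕ} {M : Type*} [TopologicalSpace M]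
  [ChartedSpace (EuclideanSpace ℝ (Fin (2 * n))) M] [IsManifold (𝓡 (2 * n)) ∞ M]

/-- The one-form `d^c_J ρ`, given by `d^c_J ρ (v) = -dρ (J v)`. -/
def dc (J : AlmostComplexStructure n M) (ρ : M → ℝ) (p : M) :
    TangentSpace (𝓡 (2 * n)) p →L[ℝ] ℝ :=
  -(mfderiv (𝓡 (2 * n)) 𝓘(ℝ, ℝ) ρ p : TangentSpace (𝓡 (2 * n)) p →L[ℝ] ℝ).comp (J.toFun p)

/-- The Levi form `L_J ρ (p, v) = (d d^c_J ρ)_p (v, J_p v)`. -/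
def leviForm (J : AlmostComplexStructure n M) (ρ : M → ℝ) (p : M)
    (v : TangentSpace (𝓡 (2 * n)) p) : ℝ :=
  OneForm.extDerivAt (J.dc ρ) p v (J.toFun p v)

/-- `ρ` is strictly `J`-plurisubharmonic on `U`: its Levi form is positive on all non-zero tangent
vectors at points of `U`. It is meant for `U` open and `ρ` smooth on `U`. -/
def StrictlyPlurisubharmonicOn (J : AlmostComplexStructure n M) (ρ : M → ℝ) (U : Set M) : Prop :=
  ∀ p ∈ U, ∀ v : TangentSpace (𝓡 (2 * n)) p, v ≠ 0 → 0 < J.leviForm ρ p v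

/-- `D` is a strongly `J`-pseudoconvex region: a domain (a non-empty connected open set) which is
`{ρ < 0}` for a smooth defining function `ρ` (in particular `dρ ≠ 0` along the boundary of `D`)
that is defined and strictly `J`-plurisubharmonic on an open neighbourhood `U` of the closure
of `D`. The values of `ρ` outside `U` play no role. -/
def IsStronglyPseudoconvexRegion (J : AlmostComplexStructure n M) (D : Set M) : Prop :=
  IsOpen D ∧ IsConnected D ∧
    ∃ (U : Set M) (ρ : M → ℝ), IsOpen U ∧ closure D ⊆ U ∧
      ContMDiffOn (𝓡 (2 * n)) 𝓘(ℝ, ℝ) ∞ ρ U ∧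
      D = {p ∈ U | ρ p < 0} ∧
      (∀ p ∈ frontier D, mfderiv (𝓡 (2 * n)) 𝓘(ℝ, ℝ) ρ p ≠ 0) ∧
      J.StrictlyPlurisubharmonicOn ρ U

end AlmostComplexStructure

end

/-! The boundary is `{ρ = 0}` in the compact connected set `C = closure D`. As `c` decreases from
`0`, the sets `C ∩ {ρ ≥ c}` grow from the boundary to all of `C`, so a splitting of the boundary has
to disappear at some level. In Morse terms, descending past a critical point attaches a handle whose
index is the number of positive directions of the Hessian `H` of `ρ`, and only a handle of index 1
can join two components.

That index is at least 2. At a critical point the derivatives of `J` drop out and the Levi form is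
`H(v,v) + H(Jv,Jv)`, so `H` is positive on `v` or on `Jv` for each `v ≠ 0`. In real dimension at
least 3 this yields a plane on which `H` is positive definite (`exists_plane_pos_of_add_pos`).

Degenerate critical points are allowed, so handles are replaced by a local statement: near `p`,
points of `{ρ ≥ ρ p}` are joined by paths that lie in `{ρ > ρ p}` except at their ends. Each point
climbs to the neighbourhood of a small circle in the positive plane, and the circle is connected
(`exists_nhds_joinedIn_of_hessian_pos`). `isConnected_setOf_eq_zero_of_local_joinedIn` passes from
local to global by examining the infimum of the levels to which a splitting of the boundary extends.
-/

/-! ### Splittings of superlevel sets -/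

/-- If `f ≤ 0` on a compact connected set `C` and the superlevel sets `{f > c}`, `c < 0`, are dense in
`{f ≥ c}` and locally path connected up to their boundary, then `{f = 0}` is connected. -/
theorem isConnected_setOf_eq_zero_of_local_joinedIn {X : Type*} [TopologicalSpace X] [T2Space X]
    {C : Set X} (hC : IsCompact C) (hconn : IsConnected C) {f : X → ℝ} (hf : ContinuousOn f C)
    (hf0 : ∀ x ∈ C, f x ≤ 0)
    (hloc : ∀ c < 0, ∀ p ∈ C, c ≤ f p → p ∈ closure (C ∩ {x | c < f x}) ∧
      ∃ V ∈ 𝓝 p, ∀ x ∈ V, ∀ y ∈ V, x ∈ C ∩ {x | c < f x} → y ∈ C ∩ {x | c < f x} →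
        JoinedIn (C ∩ {x | c < f x}) x y) :
    IsConnected (C ∩ {x | f x = 0}) := by
  have hclosed : ∀ c, IsClosed (C ∩ {x | c ≤ f x}) := fun c ↦
    hf.preimage_isClosed_of_isClosed hC.isClosed isClosed_Ici
  have hzero : C ∩ {x | f x = 0} = C ∩ {x | 0 ≤ f x} := by
    ext x
    exact ⟨fun h ↦ ⟨h.1, h.2.ge⟩, fun h ↦ ⟨h.1, le_antisymm (hf0 x h.1) h.2⟩⟩
  refine ⟨?_, ?_⟩
  -- If the maximum were negative, density at its own level would produce a larger value.
  · obtain ⟨p, hp, hmax⟩ := hC.exists_isMaxOn hconn.nonempty hf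
    refine ⟨p, hp, ?_⟩
    by_contra hne
    have hlt : f p < 0 := lt_of_le_of_ne (hf0 p hp) hne
    obtain ⟨x, hxC, hx⟩ := closure_nonempty_iff.1 ⟨p, (hloc (f p) hlt p hp le_rfl).1⟩
    exact absurd (show f x ≤ f p from hmax hxC) (not_le.2 hx)
  rw [hzero, isPreconnected_iff_subset_of_fully_disjoint_closed (hclosed 0)]
  intro A B hA hB hAB hdisj
  by_contra! hcon
  obtain ⟨⟨b, hb, hbA⟩, ⟨a, ha, haB⟩⟩ : (∃ b ∈ C ∩ {x | 0 ≤ f x}, b ∉ A) ∧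
      (∃ a ∈ C ∩ {x | 0 ≤ f x}, a ∉ B) := by
    simpa only [Set.not_subset] using hcon
  have haA : a ∈ A := (hAB ha).resolve_right haB
  have hbB : b ∈ B := (hAB hb).resolve_left hbA
  -- The splitting of the zero set into its parts in `A` and `B` extends to level `c`. This persists
  -- when `c` increases and fails at the minimum of `f`, where the superlevel set is all of `C`.
  let Sep : ℝ → Prop := fun c ↦ ∃ P Q : Set X, IsClosed P ∧ IsClosed Q ∧ Disjoint P Q ∧
    C ∩ {x | c ≤ f x} ⊆ P ∪ Q ∧
    (∀ x ∈ C ∩ {x | 0 ≤ f x}, x ∈ A → x ∈ P) ∧ (∀ x ∈ C ∩ {x | 0 ≤ f x}, x ∈ B → x ∈ Q)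
  have hSep0 : Sep 0 := ⟨A, B, hA, hB, hdisj, hAB, fun _ _ h ↦ h, fun _ _ h ↦ h⟩
  have hmono : ∀ c d, c ≤ d → Sep c → Sep d := by
    rintro c d hcd ⟨P, Q, hP, hQ, hPQ, hcov, h1, h2⟩
    exact ⟨P, Q, hP, hQ, hPQ, fun x hx ↦ hcov ⟨hx.1, hcd.trans hx.2⟩, h1, h2⟩
  obtain ⟨q, hq, hmin⟩ := hC.exists_isMinOn hconn.nonempty hf
  have hbound : ∀ c, Sep c → f q < c := by
    rintro c ⟨P, Q, hP, hQ, hPQ, hcov, h1, h2⟩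
    by_contra! hle
    have hcov' : C ⊆ P ∪ Q := fun x hx ↦ hcov ⟨hx, hle.trans (hmin hx)⟩
    rcases (isPreconnected_iff_subset_of_fully_disjoint_closed hC.isClosed).1
      hconn.isPreconnected P Q hP hQ hcov' hPQ with h | h
    · exact Set.disjoint_left.1 hPQ (h hb.1) (h2 b hb hbB)
    · exact Set.disjoint_left.1 hPQ (h1 a ha haA) (h ha.1)
  -- Disjoint open neighbourhoods of the two pieces leave a compact remainder on which `f < c`; its
  -- maximum is still below `c`, which leaves room for a lower level.
  have hopen : ∀ c, c ≤ 0 → Sep c → ∃ d < c, Sep d := by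
    rintro c hc0 ⟨P, Q, hP, hQ, hPQ, hcov, h1, h2⟩
    obtain ⟨O₁, O₂, hO₁, hO₂, hPO, hQO, hO⟩ := SeparatedNhds.of_isCompact_isCompact
      (hC.inter_right hP) (hC.inter_right hQ)
      (hPQ.mono Set.inter_subset_right Set.inter_subset_right)
    have hR : IsCompact (C \ (O₁ ∪ O₂)) := hC.diff (hO₁.union hO₂)
    have hRlt : ∀ x ∈ C \ (O₁ ∪ O₂), f x < c := by
      intro x hx
      by_contra! hle
      rcases hcov ⟨hx.1, hle⟩ with h | h
      · exact hx.2 (Or.inl (hPO ⟨hx.1, h⟩))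
      · exact hx.2 (Or.inr (hQO ⟨hx.1, h⟩))
    obtain ⟨d, hdc, hd⟩ : ∃ d < c, ∀ x ∈ C \ (O₁ ∪ O₂), f x < d := by
      rcases (C \ (O₁ ∪ O₂)).eq_empty_or_nonempty with he | hne
      · exact ⟨c - 1, by linarith, by simp [he]⟩
      · obtain ⟨z, hz, hzmax⟩ := hR.exists_isMaxOn hne (hf.mono Set.sdiff_subset)
        obtain ⟨d, hd1, hd2⟩ := exists_between (hRlt z hz)
        exact ⟨d, hd2, fun x hx ↦ (hzmax hx).trans_lt hd1⟩
    have hcov' : ∀ x ∈ C ∩ {x | d ≤ f x}, x ∈ O₁ ∪ O₂ := by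
      intro x hx
      by_contra h
      exact absurd (hd x ⟨hx.1, h⟩) (not_lt.2 hx.2)
    refine ⟨d, hdc, (C ∩ {x | d ≤ f x}) \ O₂, (C ∩ {x | d ≤ f x}) \ O₁,
      (hclosed d).sdiff hO₂, (hclosed d).sdiff hO₁, ?_, ?_, ?_, ?_⟩
    · rw [Set.disjoint_left]
      rintro x ⟨hx, hx2⟩ ⟨-, hx1⟩
      exact (hcov' x hx).elim hx1 hx2
    · intro x hx
      rcases hcov' x hx with h | h
      · exact Or.inl ⟨hx, fun h' ↦ Set.disjoint_left.1 hO h h'⟩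
      · exact Or.inr ⟨hx, fun h' ↦ Set.disjoint_left.1 hO h' h⟩
    · intro x hx hxA
      exact ⟨⟨hx.1, (hdc.le.trans hc0).trans hx.2⟩,
        fun h' ↦ Set.disjoint_left.1 hO (hPO ⟨hx.1, h1 x hx hxA⟩) h'⟩
    · intro x hx hxB
      exact ⟨⟨hx.1, (hdc.le.trans hc0).trans hx.2⟩,
        fun h' ↦ Set.disjoint_left.1 hO h' (hQO ⟨hx.1, h2 x hx hxB⟩)⟩
  have hlim : ∀ c < 0, (∀ d, c < d → Sep d) → Sep c := by
    intro c hc0 hS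
    set S := C ∩ {x | c < f x} with hSdef
    have hsub : ∀ x ∈ C ∩ {x | 0 ≤ f x}, x ∈ S := fun x hx ↦ ⟨hx.1, hc0.trans_le hx.2⟩
    -- The splitting at the limit level: points of `{f > c}` reachable from the `A` part inside `{f
    -- > c}`, against the others. Local joinedness keeps the two closures disjoint, and density
    -- makes them cover `{f ≥ c}`.
    let W : Set X := {x | x ∈ S ∧ ∃ a ∈ C ∩ {x | 0 ≤ f x}, a ∈ A ∧ JoinedIn S a x}
    refine ⟨closure W, closure (S \ W), isClosed_closure, isClosed_closure, ?_, ?_, ?_, ?_⟩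
    · rw [Set.disjoint_left]
      intro p hp1 hp2
      have hpS : p ∈ C ∩ {x | c ≤ f x} := by
        refine (closure_minimal ?_ (hclosed c)) hp1
        rintro x ⟨⟨hxC, hx⟩, -⟩
        exact ⟨hxC, le_of_lt (show c < f x from hx)⟩
      obtain ⟨V, hV, hVj⟩ := (hloc c hc0 p hpS.1 hpS.2).2
      obtain ⟨x, hxV, hxS, a', ha', ha'A, hj⟩ := mem_closure_iff_nhds.1 hp1 V hV
      obtain ⟨y, hyV, hyS, hyW⟩ := mem_closure_iff_nhds.1 hp2 V hV
      exact hyW ⟨hyS, a', ha', ha'A, hj.trans (hVj x hxV y hyV hxS hyS)⟩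
    · intro p hp
      rw [← closure_union]
      refine closure_mono ?_ (hloc c hc0 p hp.1 hp.2).1
      intro x hx
      by_cases h : x ∈ W
      · exact Or.inl h
      · exact Or.inr ⟨hx, h⟩
    · exact fun x hx hxA ↦ subset_closure ⟨hsub x hx, x, hx, hxA, JoinedIn.refl (hsub x hx)⟩
    · refine fun x hx hxB ↦ subset_closure ⟨hsub x hx, ?_⟩
      rintro ⟨-, a', ha', ha'A, γ, hγ⟩
      have hrange : Set.range γ ⊆ S := Set.range_subset_iff.2 hγ
      have hcompact : IsCompact (Set.range γ) := isCompact_range γ.continuous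
      -- A path from `A` to `B` in `{f > c}` has a minimum value above `c`, a level at which a
      -- splitting is known to exist.
      obtain ⟨z, hz, hzmin⟩ := hcompact.exists_isMinOn (Set.range_nonempty γ)
        (hf.mono (hrange.trans Set.inter_subset_left))
      obtain ⟨P, Q, hP, hQ, hPQ, hcov, h1, h2⟩ := hS (f z) (hrange hz).2
      have hcov' : Set.range γ ⊆ P ∪ Q := fun y hy ↦ hcov ⟨(hrange hy).1, hzmin hy⟩
      have ha'γ : a' ∈ Set.range γ := ⟨0, γ.source⟩
      have hxγ : x ∈ Set.range γ := ⟨1, γ.target⟩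
      rcases (isPreconnected_iff_subset_of_fully_disjoint_closed hcompact.isClosed).1
        (isPreconnected_range γ.continuous) P Q hP hQ hcov' hPQ with h | h
      · exact Set.disjoint_left.1 hPQ (h hxγ) (h2 x hx hxB)
      · exact Set.disjoint_left.1 hPQ (h1 a' ha' ha'A) (h ha'γ)
  have hbdd : BddBelow {c | Sep c} := ⟨f q, fun c hc ↦ (hbound c hc).le⟩
  have hne : {c | Sep c}.Nonempty := ⟨0, hSep0⟩
  have hinf0 : sInf {c | Sep c} ≤ 0 := csInf_le hbdd hSep0
  have hinf : Sep (sInf {c | Sep c}) := by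
    rcases hinf0.eq_or_lt with h | h
    · rwa [h]
    · refine hlim _ h fun d hd ↦ ?_
      obtain ⟨c, hc, hcd⟩ := exists_lt_of_csInf_lt hne hd
      exact hmono c d hcd.le hc
  obtain ⟨d, hd, hdS⟩ := hopen _ hinf0 hinf
  exact absurd (csInf_le hbdd hdS) (not_le.2 hd)

/-! ### Local connectedness of superlevel sets in a normed space -/

/-- If every point of `{f ≥ c}` near `y₀` can be moved, with `f` increasing, by a vector of a compact
path connected set `Z` with `y₀ + Z ⊆ {f > c}`, then `{f ≥ c}` is locally path connected at `y₀`, by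
paths that enter `{f > c}` at once. -/
theorem exists_nhds_joinedIn_of_increasing_directions {E : Type*} [NormedAddCommGroup E]
    [NormedSpace ℝ E] {f : E → ℝ} {y₀ : E} {N Z : Set E} {c : ℝ} (hN : IsOpen N)
    (hf : ContinuousOn f N) (hZ : IsCompact Z) (hZc : IsPathConnected Z)
    (hZN : ∀ u ∈ Z, y₀ + u ∈ N ∧ c < f (y₀ + u))
    (hdir : ∀ᶠ x in 𝓝 y₀, ∃ u ∈ Z, ∀ t ∈ Set.Ioc (0 : ℝ) 1, x + t • u ∈ N ∧ f x < f (x + t • u)) :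
    ∃ V ∈ 𝓝 y₀, ∀ x ∈ V, ∀ y ∈ V, c ≤ f x → c ≤ f y →
      JoinedIn ({x, y} ∪ (N ∩ {z | c < f z})) x y := by
  set W := N ∩ {z | c < f z} with hW
  have hWo : IsOpen W := hf.isOpen_inter_preimage hN isOpen_Ioi
  have hKc : IsCompact ((fun u ↦ y₀ + u) '' Z) := hZ.image (by fun_prop)
  have hKW : (fun u ↦ y₀ + u) '' Z ⊆ W := by
    rintro _ ⟨u, hu, rfl⟩
    exact hZN u hu
  have hKp : IsPathConnected ((fun u ↦ y₀ + u) '' Z) := hZc.image (by fun_prop)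
  -- By compactness one radius `s` serves all of `y₀ + Z`: for `x` within `s` of `y₀`, the segment
  -- from `x + u` to `y₀ + u` stays in `W`.
  obtain ⟨s, hs, hsW⟩ := hKc.exists_thickening_subset_open hWo hKW
  have key : ∀ x ∈ Metric.ball y₀ s, c ≤ f x →
      (∃ u ∈ Z, ∀ t ∈ Set.Ioc (0 : ℝ) 1, x + t • u ∈ N ∧ f x < f (x + t • u)) →
      ∃ z ∈ (fun u ↦ y₀ + u) '' Z, JoinedIn ({x} ∪ W) x z := by
    rintro x hx hcx ⟨u, hu, hut⟩
    refine ⟨y₀ + u, ⟨u, hu, rfl⟩, ?_⟩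
    have h1 : JoinedIn ({x} ∪ W) x (x + u) := by
      apply JoinedIn.of_segment_subset
      rw [segment_eq_image']
      rintro _ ⟨t, ht, rfl⟩
      rcases ht.1.eq_or_lt with h0 | h0
      · left
        simp [← h0]
      · right
        have := hut t ⟨h0, ht.2⟩
        simp only [add_sub_cancel_left]
        exact ⟨this.1, hcx.trans_lt this.2⟩
    have h2 : JoinedIn ({x} ∪ W) (x + u) (y₀ + u) := by
      apply JoinedIn.of_segment_subset
      refine subset_trans ?_ (hsW.trans Set.subset_union_right)
      refine subset_trans ?_ (Metric.ball_subset_thickening (Set.mem_image_of_mem _ hu) s)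
      refine (convex_ball _ _).segment_subset ?_ (Metric.mem_ball_self hs)
      simpa [mem_ball_iff_norm] using hx
    exact h1.trans h2
  refine ⟨_, Filter.inter_mem (Metric.ball_mem_nhds y₀ hs) hdir, ?_⟩
  intro x hx y hy hcx hcy
  obtain ⟨z, hz, hxz⟩ := key x hx.1 hcx hx.2
  obtain ⟨w, hw, hyw⟩ := key y hy.1 hcy hy.2
  refine (hxz.mono ?_).trans ((((hKp.joinedIn z hz w hw).mono hKW).mono ?_).trans
    (hyw.mono ?_).symm)
  · exact Set.union_subset_union_left _ (by simp)
  · exact Set.subset_union_right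
  · exact Set.union_subset_union_left _ (by simp)

/-- Near a regular point `y₀` of `f`, the set `{f ≥ f y₀}` is locally path connected, and `y₀` is in
the closure of `{f > f y₀}`. -/
theorem exists_nhds_joinedIn_of_fderiv_ne_zero {E : Type*} [NormedAddCommGroup E]
    [NormedSpace ℝ E] {f : E → ℝ} {y₀ : E} (hf : ContDiffAt ℝ 1 f y₀) (hd : fderiv ℝ f y₀ ≠ 0)
    {N : Set E} (hN : N ∈ 𝓝 y₀) :
    (∃ z ∈ N, f y₀ < f z) ∧
    ∃ V ∈ 𝓝 y₀, ∀ x ∈ V, ∀ y ∈ V, f y₀ ≤ f x → f y₀ ≤ f y →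
      JoinedIn ({x, y} ∪ (N ∩ {z | f y₀ < f z})) x y := by
  obtain ⟨e, he⟩ : ∃ e, 0 < fderiv ℝ f y₀ e := by
    obtain ⟨e, he⟩ := DFunLike.ne_iff.1 hd
    rcases lt_or_gt_of_ne he with h | h
    · exact ⟨-e, by simpa using h⟩
    · exact ⟨e, by simpa using h⟩
  have he0 : 0 < ‖e‖ := norm_pos_iff.2 (by rintro rfl; simp at he)
  have hstrict := hf.hasStrictFDerivAt (by simp)
  have hcont : ∀ᶠ z in 𝓝 y₀, ContinuousAt f z :=
    (hf.eventually (by simp)).mono fun z hz ↦ hz.continuousAt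
  obtain ⟨δ₁, hδ₁, h1⟩ := Metric.mem_nhds_iff.1 (Filter.inter_mem hN hcont)
  -- This constant bounds the error along `e` by half of the linear gain, uniformly in the base
  -- point.
  have h2 := (Asymptotics.isLittleO_iff.1 hstrict.isLittleO)
    (show 0 < fderiv ℝ f y₀ e / (2 * ‖e‖) by positivity)
  obtain ⟨δ₂, hδ₂, h2⟩ := Metric.eventually_nhds_iff_ball.1 h2
  set δ := min δ₁ δ₂ with hδ
  have hδ0 : 0 < δ := lt_min hδ₁ hδ₂
  -- Steps of length at most `δ / 4` keep the `δ / 2` ball inside the `δ` ball.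
  set r := δ / (4 * ‖e‖) with hr
  have hr0 : 0 < r := by positivity
  have hre : r * ‖e‖ = δ / 4 := by rw [hr]; field_simp
  have hball : ∀ x ∈ Metric.ball y₀ (δ / 2), ∀ t ∈ Set.Ioc (0 : ℝ) 1,
      x + t • r • e ∈ Metric.ball y₀ δ ∧ f x < f (x + t • r • e) := by
    intro x hx t ht
    have hmem : x + t • r • e ∈ Metric.ball y₀ δ := by
      rw [mem_ball_iff_norm] at hx ⊢
      have : ‖t • r • e‖ ≤ δ / 4 := by
        rw [norm_smul, norm_smul, Real.norm_of_nonneg ht.1.le, Real.norm_of_nonneg hr0.le, hre]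
        nlinarith [ht.2]
      calc ‖x + t • r • e - y₀‖ = ‖(x - y₀) + t • r • e‖ := by congr 1; abel
        _ ≤ ‖x - y₀‖ + ‖t • r • e‖ := norm_add_le _ _
        _ < δ := by linarith
    refine ⟨hmem, ?_⟩
    have hx' : x ∈ Metric.ball y₀ δ := Metric.ball_subset_ball (by linarith) hx
    have := h2 (x + t • r • e, x) (by
      rw [← ball_prod_same]
      exact ⟨Metric.ball_subset_ball (min_le_right _ _) hmem,
        Metric.ball_subset_ball (min_le_right _ _) hx'⟩)
    simp only [add_sub_cancel_left, map_smul, smul_eq_mul, norm_smul, Real.norm_of_nonneg ht.1.le,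
      Real.norm_of_nonneg hr0.le] at this
    have h3 : fderiv ℝ f y₀ e / (2 * ‖e‖) * (t * (r * ‖e‖)) = t * (r * fderiv ℝ f y₀ e) / 2 := by
      field_simp
    rw [h3, Real.norm_eq_abs, abs_le] at this
    have h4 : 0 < t * (r * fderiv ℝ f y₀ e) := mul_pos ht.1 (mul_pos hr0 he)
    linarith [this.1]
  have hsub : Metric.ball y₀ δ ⊆ N ∩ {z | ContinuousAt f z} :=
    (Metric.ball_subset_ball (min_le_left _ _)).trans h1
  have hy₀ := hball y₀ (Metric.mem_ball_self (by linarith)) 1 (by simp)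
  refine ⟨⟨_, (hsub hy₀.1).1, hy₀.2⟩, ?_⟩
  obtain ⟨V, hV, h⟩ := exists_nhds_joinedIn_of_increasing_directions (f := f) (y₀ := y₀)
    (c := f y₀) (N := Metric.ball y₀ δ) (Z := {r • e}) Metric.isOpen_ball
    (fun z hz ↦ (hsub hz).2.continuousWithinAt) isCompact_singleton
    (isPathConnected_singleton _) (by simpa using hy₀)
    (Filter.eventually_of_mem (Metric.ball_mem_nhds y₀ (by linarith : 0 < δ / 2))
      fun x hx ↦ ⟨_, rfl, hball x hx⟩)
  refine ⟨V, hV, fun x hx y hy hcx hcy ↦ (h x hx y hy hcx hcy).mono ?_⟩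
  exact Set.union_subset_union_right _ (Set.inter_subset_inter_left _ fun z hz ↦ (hsub hz).1)

/-- A function on a line with positive second derivative and nonnegative initial derivative
increases. -/
theorem lt_add_smul_of_fderiv_fderiv_pos {E : Type*} [NormedAddCommGroup E]
    [NormedSpace ℝ E] {f : E → ℝ} {x u : E}
    (hf : ∀ t ∈ Set.Icc (0 : ℝ) 1, ContDiffAt ℝ 2 f (x + t • u))
    (hpos : ∀ t ∈ Set.Icc (0 : ℝ) 1, 0 < fderiv ℝ (fderiv ℝ f) (x + t • u) u u)
    (h0 : 0 ≤ fderiv ℝ f x u) : ∀ t ∈ Set.Ioc (0 : ℝ) 1, f x < f (x + t • u) := by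
  have hline : ∀ t : ℝ, HasDerivAt (fun t : ℝ ↦ x + t • u) u t := fun t ↦ by
    simpa using ((hasDerivAt_id t).smul_const u).const_add x
  have h1 : ∀ t ∈ Set.Icc (0 : ℝ) 1,
      HasDerivAt (fun t : ℝ ↦ f (x + t • u)) (fderiv ℝ f (x + t • u) u) t := by
    intro t ht
    have hd : DifferentiableAt ℝ f (x + t • u) := (hf t ht).differentiableAt (by simp)
    exact HasFDerivAt.comp_hasDerivAt (f := fun t : ℝ ↦ x + t • u) t hd.hasFDerivAt (hline t)
  have h2 : ∀ t ∈ Set.Icc (0 : ℝ) 1, HasDerivAt (fun t : ℝ ↦ fderiv ℝ f (x + t • u) u)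
      (fderiv ℝ (fderiv ℝ f) (x + t • u) u u) t := by
    intro t ht
    have hd : DifferentiableAt ℝ (fderiv ℝ f) (x + t • u) :=
      ((hf t ht).fderiv_right (m := 1) (by norm_num)).differentiableAt (by simp)
    have hd' : DifferentiableAt ℝ (fun y ↦ fderiv ℝ f y u) (x + t • u) :=
      hd.clm_apply (differentiableAt_const u)
    have hd'' : fderiv ℝ (fun y ↦ fderiv ℝ f y u) (x + t • u) u =
        fderiv ℝ (fderiv ℝ f) (x + t • u) u u := by
      rw [fderiv_clm_apply hd (differentiableAt_const u)]
      simp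
    rw [← hd'']
    exact HasFDerivAt.comp_hasDerivAt (f := fun t : ℝ ↦ x + t • u) t hd'.hasFDerivAt (hline t)
  have hm1 : StrictMonoOn (fun t : ℝ ↦ fderiv ℝ f (x + t • u) u) (Set.Icc 0 1) := by
    refine strictMonoOn_of_deriv_pos (convex_Icc _ _)
      (fun t ht ↦ (h2 t ht).continuousAt.continuousWithinAt) fun t ht ↦ ?_
    rw [(h2 t (interior_subset ht)).deriv]
    exact hpos t (interior_subset ht)
  have hm0 : StrictMonoOn (fun t : ℝ ↦ f (x + t • u)) (Set.Icc 0 1) := by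
    refine strictMonoOn_of_deriv_pos (convex_Icc _ _)
      (fun t ht ↦ (h1 t ht).continuousAt.continuousWithinAt) fun t ht ↦ ?_
    rw [(h1 t (interior_subset ht)).deriv]
    rw [interior_Icc] at ht
    have h3 : fderiv ℝ f (x + (0 : ℝ) • u) u < fderiv ℝ f (x + t • u) u :=
      hm1 (by simp) (Set.Ioo_subset_Icc_self ht) ht.1
    rw [zero_smul, add_zero] at h3
    exact h0.trans_lt h3
  intro t ht
  have h3 : f (x + (0 : ℝ) • u) < f (x + t • u) :=
    hm0 (by simp) (Set.Ioc_subset_Icc_self ht) ht.1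
  rwa [zero_smul, add_zero] at h3

/-- Near a critical point `y₀` of `f` at which the Hessian is positive definite on a plane, the set
`{f ≥ f y₀}` is locally path connected, and `y₀` is in the closure of `{f > f y₀}`. -/
theorem exists_nhds_joinedIn_of_hessian_pos {E : Type*} [NormedAddCommGroup E]
    [NormedSpace ℝ E] {f : E → ℝ} {y₀ : E} (hf : ContDiffAt ℝ 2 f y₀) (hd : fderiv ℝ f y₀ = 0)
    {v w : E} (hpos : ∀ a b : ℝ, a ^ 2 + b ^ 2 = 1 →
      0 < fderiv ℝ (fderiv ℝ f) y₀ (a • v + b • w) (a • v + b • w))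
    {N : Set E} (hN : N ∈ 𝓝 y₀) :
    (∃ z ∈ N, f y₀ < f z) ∧
    ∃ V ∈ 𝓝 y₀, ∀ x ∈ V, ∀ y ∈ V, f y₀ ≤ f x → f y₀ ≤ f y →
      JoinedIn ({x, y} ∪ (N ∩ {z | f y₀ < f z})) x y := by
  -- The unit circle of the plane, in the coordinates `a`, `b`; scaled by `r`, it is the connected
  -- set of directions.
  let g : ℝ → E := fun θ ↦ Real.cos θ • v + Real.sin θ • w
  have hg : Continuous g := by fun_prop
  have hgper : g '' Set.Icc 0 (2 * Real.pi) = Set.range g := by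
    have hp : Function.Periodic g (2 * Real.pi) := fun θ ↦ by simp [g]
    simpa using hp.image_Icc Real.two_pi_pos 0
  have hKc : IsCompact (Set.range g) := hgper ▸ isCompact_Icc.image hg
  have hgpos : ∀ u ∈ Set.range g, 0 < fderiv ℝ (fderiv ℝ f) y₀ u u := by
    rintro _ ⟨θ, rfl⟩
    exact hpos _ _ (by simp)
  have hcont : ContinuousAt (fderiv ℝ (fderiv ℝ f)) y₀ :=
    ((hf.fderiv_right (m := 1) (by norm_num)).fderiv_right (m := 0) (by norm_num)).continuousAt
  have hev : ∀ᶠ z in 𝓝 y₀, ∀ u ∈ Set.range g, 0 < fderiv ℝ (fderiv ℝ f) z u u := by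
    refine hKc.eventually_forall_of_forall_eventually fun u hu ↦ ?_
    have hc : ContinuousAt (fun p : E × E ↦ fderiv ℝ (fderiv ℝ f) p.1 p.2 p.2) (y₀, u) := by
      have : ContinuousAt (fun p : E × E ↦ fderiv ℝ (fderiv ℝ f) p.1) (y₀, u) :=
        ContinuousAt.comp (f := Prod.fst) (x := (y₀, u)) hcont continuousAt_fst
      exact (this.clm_apply continuousAt_snd).clm_apply continuousAt_snd
    exact hc.eventually (lt_mem_nhds (hgpos u hu))
  obtain ⟨δ, hδ, hball⟩ := Metric.eventually_nhds_iff_ball.1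
    ((hev.and (hf.eventually (by simp))).and (Filter.eventually_mem_set.2 hN))
  obtain ⟨R, hR⟩ := hKc.isBounded.exists_norm_le
  have hR0 : 0 ≤ R := (norm_nonneg _).trans (hR _ ⟨0, rfl⟩)
  set r := δ / (4 * (R + 1)) with hr
  have hr0 : 0 < r := by positivity
  have hrR : r * R ≤ δ / 4 := by
    rw [hr, div_mul_eq_mul_div, div_le_div_iff₀ (by positivity) (by norm_num)]
    nlinarith
  have hmem : ∀ x ∈ Metric.ball y₀ (δ / 2), ∀ u ∈ Set.range g, ∀ t ∈ Set.Icc (0 : ℝ) 1,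
      x + t • r • u ∈ Metric.ball y₀ δ := by
    intro x hx u hu t ht
    rw [mem_ball_iff_norm] at hx ⊢
    have : ‖t • r • u‖ ≤ δ / 4 := by
      rw [norm_smul, norm_smul, Real.norm_of_nonneg ht.1, Real.norm_of_nonneg hr0.le]
      have h1 : r * ‖u‖ ≤ r * R := mul_le_mul_of_nonneg_left (hR u hu) hr0.le
      have h2 : 0 ≤ r * ‖u‖ := by positivity
      nlinarith [ht.2, ht.1]
    calc ‖x + t • r • u - y₀‖ = ‖(x - y₀) + t • r • u‖ := by congr 1; abel
      _ ≤ ‖x - y₀‖ + ‖t • r • u‖ := norm_add_le _ _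
      _ < δ := by linarith
  have hinc : ∀ x ∈ Metric.ball y₀ (δ / 2), ∀ u ∈ Set.range g, 0 ≤ fderiv ℝ f x u →
      ∀ t ∈ Set.Ioc (0 : ℝ) 1, f x < f (x + t • r • u) := by
    intro x hx u hu hxu
    refine lt_add_smul_of_fderiv_fderiv_pos (fun t ht ↦ (hball _ (hmem x hx u hu t ht)).1.2)
      (fun t ht ↦ ?_) ?_
    · have := (hball _ (hmem x hx u hu t ht)).1.1 u hu
      simp only [map_smul, smul_apply, smul_eq_mul]
      positivity
    · simp only [map_smul, smul_eq_mul]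
      positivity
  have hy₀ : y₀ ∈ Metric.ball y₀ (δ / 2) := Metric.mem_ball_self (by linarith)
  have hyu : ∀ u ∈ Set.range g, y₀ + r • u ∈ Metric.ball y₀ δ ∧ f y₀ < f (y₀ + r • u) := by
    intro u hu
    have h1 := hmem y₀ hy₀ u hu 1 (by simp)
    have h2 := hinc y₀ hy₀ u hu (by simp [hd]) 1 (by simp)
    rw [one_smul] at h1 h2
    exact ⟨h1, h2⟩
  refine ⟨⟨_, (hball _ (hyu _ ⟨0, rfl⟩).1).2, (hyu _ ⟨0, rfl⟩).2⟩, ?_⟩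
  have hZ : (fun u ↦ r • u) '' Set.range g = Set.range (fun θ ↦ r • g θ) := by
    rw [← Set.range_comp]; rfl
  obtain ⟨V, hV, h⟩ := exists_nhds_joinedIn_of_increasing_directions (f := f) (y₀ := y₀)
    (c := f y₀) (N := Metric.ball y₀ δ) (Z := (fun u ↦ r • u) '' Set.range g) Metric.isOpen_ball
    (fun z hz ↦ (hball z hz).1.2.continuousAt.continuousWithinAt) (hKc.image (by fun_prop))
    (by rw [hZ]; exact isPathConnected_range (by fun_prop))
    (by rintro _ ⟨u, hu, rfl⟩; exact hyu u hu)
    (Filter.eventually_of_mem (Metric.ball_mem_nhds y₀ (by linarith : 0 < δ / 2)) fun x hx ↦ by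
      -- One of `v` and `-v` has nonnegative initial slope. The rest of the circle only serves to
      -- connect these two directions above the level.
      obtain ⟨u, hu, hxu⟩ : ∃ u ∈ Set.range g, 0 ≤ fderiv ℝ f x u := by
        rcases le_total 0 (fderiv ℝ f x (g 0)) with h | h
        · exact ⟨_, ⟨0, rfl⟩, h⟩
        · exact ⟨g Real.pi, ⟨_, rfl⟩, by simpa [g] using h⟩
      exact ⟨_, Set.mem_image_of_mem _ hu, fun t ht ↦
        ⟨hmem x hx u hu t (Set.Ioc_subset_Icc_self ht), hinc x hx u hu hxu t ht⟩⟩)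
  refine ⟨V, hV, fun x hx y hy hcx hcy ↦ (h x hx y hy hcx hcy).mono ?_⟩
  exact Set.union_subset_union_right _ (Set.inter_subset_inter_left _ fun z hz ↦ (hball z hz).2)

/-! ### The positive plane and the exterior derivative -/

/-- If `H v v + H (J v) (J v) > 0` for `v ≠ 0`, then `H` is positive definite on a
plane as soon as the real dimension is at least `3`. -/
theorem exists_plane_pos_of_add_pos {E : Type*} [NormedAddCommGroup E] [NormedSpace ℝ E]
    [FiniteDimensional ℝ E] (hdim : 3 ≤ Module.finrank ℝ E) (H : E →L[ℝ] E →L[ℝ] ℝ)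
    (J : E →L[ℝ] E) (hpos : ∀ v ≠ 0, 0 < H v v + H (J v) (J v)) :
    ∃ v w : E, ∀ a b : ℝ, a ^ 2 + b ^ 2 = 1 → 0 < H (a • v + b • w) (a • v + b • w) := by
  have hex : ∀ z ≠ 0, 0 < H z z ∨ 0 < H (J z) (J z) := by
    intro z hz
    by_contra! h
    linarith [hpos z hz, h.1, h.2]
  obtain ⟨v, hv⟩ : ∃ v, 0 < H v v := by
    have : Nontrivial E := Module.nontrivial_of_finrank_pos (R := ℝ) (by omega)
    obtain ⟨z, hz⟩ := exists_ne (0 : E)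
    rcases hex z hz with h | h
    · exact ⟨_, h⟩
    · exact ⟨_, h⟩
  -- `H` is not assumed symmetric, so orthogonality to `v` refers to its symmetrization. Two linear
  -- conditions in dimension at least 3 leave some `z ≠ 0` with both `z` and `J z` orthogonal to
  -- `v`, and `H` is positive on one of them.
  let l : E →ₗ[ℝ] ℝ := (H v + H.flip v : E →L[ℝ] ℝ)
  let L : E →ₗ[ℝ] ℝ × ℝ := l.prod (l ∘ₗ (J : E →ₗ[ℝ] E))
  obtain ⟨z, hz, hz0⟩ : ∃ z ∈ L.ker, z ≠ 0 := by
    refine L.ker.ne_bot_iff.1 (LinearMap.ker_ne_bot_of_finrank_lt ?_)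
    rw [Module.finrank_prod, Module.finrank_self]
    omega
  have hz1 : H v z + H z v = 0 ∧ H v (J z) + H (J z) v = 0 := by
    simpa [L, l] using hz
  obtain ⟨w, hw, hvw⟩ : ∃ w, 0 < H w w ∧ H v w + H w v = 0 := by
    rcases hex z hz0 with h | h
    · exact ⟨z, h, hz1.1⟩
    · exact ⟨J z, h, hz1.2⟩
  refine ⟨v, w, fun a b hab ↦ ?_⟩
  have hexp : H (a • v + b • w) (a • v + b • w) =
      a ^ 2 * H v v + b ^ 2 * H w w + a * b * (H v w + H w v) := by
    simp only [map_add, map_smul, add_apply, smul_apply,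
      smul_eq_mul]
    ring
  rw [hexp, hvw, mul_zero, add_zero]
  rcases eq_or_ne a 0 with rfl | ha
  · have : b ^ 2 = 1 := by simpa using hab
    rw [this]
    linarith
  · have : 0 < a ^ 2 := by positivity
    positivity

/-- If `g` is differentiable at `x` with `g x = 0` and `A` is merely continuous at `x`, then
`y ↦ g y ∘ A y` is differentiable at `x`. -/
theorem HasFDerivAt.clm_comp_of_eq_zero {E F G : Type*} [NormedAddCommGroup E] [NormedSpace ℝ E]
    [NormedAddCommGroup F] [NormedSpace ℝ F] [NormedAddCommGroup G] [NormedSpace ℝ G]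
    {g : E → F →L[ℝ] G} {g' : E →L[ℝ] F →L[ℝ] G} {A : E → F →L[ℝ] F} {x : E}
    (hg : HasFDerivAt g g' x) (hgx : g x = 0) (hA : ContinuousAt A x) :
    HasFDerivAt (fun y ↦ (g y).comp (A y))
      (((ContinuousLinearMap.compL ℝ F F G).flip (A x)).comp g') x := by
  have h1 : HasFDerivAt (fun y ↦ (g y).comp (A x))
      (((ContinuousLinearMap.compL ℝ F F G).flip (A x)).comp g') x :=
    ((ContinuousLinearMap.compL ℝ F F G).flip (A x)).hasFDerivAt.comp x hg
  -- The remainder is a product of an `O(y - x)` factor and an `o(1)` factor.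
  have h2 : HasFDerivAt (fun y ↦ (g y).comp (A y - A x)) (0 : E →L[ℝ] F →L[ℝ] G) x := by
    refine .of_isLittleO ?_
    simp only [sub_self, ContinuousLinearMap.comp_zero, sub_zero, zero_apply]
    have hO : g =O[𝓝 x] fun y ↦ y - x := by simpa [hgx] using hg.isBigO_sub
    have ho : (fun y ↦ A y - A x) =o[𝓝 x] fun _ ↦ (1 : ℝ) := by
      rw [Asymptotics.isLittleO_one_iff]
      simpa using hA.sub_const (A x)
    have hb : (fun y ↦ (g y).comp (A y - A x)) =O[𝓝 x] fun y ↦ ‖g y‖ * ‖A y - A x‖ :=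
      .of_norm_le fun y ↦ (g y).opNorm_comp_le _
    refine hb.trans_isLittleO ?_
    simpa using hO.norm_norm.mul_isLittleO ho.norm_left
  simpa [Pi.add_def, ← ContinuousLinearMap.comp_add] using h1.add h2

/-- The exterior derivative of a one-form on a normed space. -/
theorem extDeriv_ofSubsingleton_apply {E : Type*} [NormedAddCommGroup E] [NormedSpace ℝ E]
    {α : E → E →L[ℝ] ℝ} {α' : E →L[ℝ] E →L[ℝ] ℝ} {x : E} (h : HasFDerivAt α α' x) (v w : E) :
    extDeriv (fun y ↦ ContinuousAlternatingMap.ofSubsingleton ℝ E ℝ (0 : Fin 1) (α y)) x ![v, w] =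
      α' v w - α' w v := by
  have hd : DifferentiableAt ℝ
      (fun y ↦ ContinuousAlternatingMap.ofSubsingleton ℝ E ℝ (0 : Fin 1) (α y)) x :=
    (ContinuousAlternatingMap.ofSubsingletonLIE (𝕜 := ℝ) (E := E) (F := ℝ) (0 : Fin 1)).differentiable
      |>.differentiableAt.comp x h.differentiableAt
  rw [extDeriv_apply hd]
  have h' : ∀ u, fderiv ℝ (fun y ↦ α y u) x = α'.flip u := by
    intro u
    ext z
    rw [fderiv_clm_apply h.differentiableAt (differentiableAt_const u), h.fderiv]
    simp
  simp [Fin.sum_univ_two, h', Fin.removeNth, sub_eq_add_neg]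

/-! ### The Levi form at a critical point -/

section Levi

variable {n : ℕ} {M : Type*} [TopologicalSpace M]
  [ChartedSpace (EuclideanSpace ℝ (Fin (2 * n))) M]

/-- A smooth function on a manifold is smooth in the preferred chart. -/
theorem ContMDiffAt.contDiffAt_comp_extChartAt_symm {ρ : M → ℝ} {p : M}
    (hρ : ContMDiffAt (𝓡 (2 * n)) 𝓘(ℝ, ℝ) ∞ ρ p) :
    ContDiffAt ℝ ∞ (ρ ∘ (extChartAt (𝓡 (2 * n)) p).symm) (extChartAt (𝓡 (2 * n)) p p) := by
  have h := (contMDiffAt_iff.1 hρ).2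
  simp only [modelWithCornersSelf_coe, Set.range_id, contDiffWithinAt_univ] at h
  exact h

variable [IsManifold (𝓡 (2 * n)) ∞ M]

namespace AlmostComplexStructure

/-- The endomorphism field `J` read in the preferred chart at `p`. -/
noncomputable def inChart (J : AlmostComplexStructure n M) (p : M)
    (y : EuclideanSpace ℝ (Fin (2 * n))) :
    EuclideanSpace ℝ (Fin (2 * n)) →L[ℝ] EuclideanSpace ℝ (Fin (2 * n)) :=
  (mfderiv (𝓡 (2 * n)) 𝓘(ℝ, EuclideanSpace ℝ (Fin (2 * n))) (extChartAt (𝓡 (2 * n)) p)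
    ((extChartAt (𝓡 (2 * n)) p).symm y)).comp
  ((J.toFun ((extChartAt (𝓡 (2 * n)) p).symm y)).comp
    (mfderiv 𝓘(ℝ, EuclideanSpace ℝ (Fin (2 * n))) (𝓡 (2 * n)) (extChartAt (𝓡 (2 * n)) p).symm y))

theorem inChart_self (J : AlmostComplexStructure n M) (p : M) :
    J.inChart p (extChartAt (𝓡 (2 * n)) p p) = J.toFun p := by
  have h1 : mfderiv (𝓡 (2 * n)) 𝓘(ℝ, EuclideanSpace ℝ (Fin (2 * n))) (extChartAt (𝓡 (2 * n)) p) p =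
      ContinuousLinearMap.id ℝ _ := mfderiv_extChartAt_self
  have h2 : mfderivWithin 𝓘(ℝ, EuclideanSpace ℝ (Fin (2 * n))) (𝓡 (2 * n))
      (extChartAt (𝓡 (2 * n)) p).symm (Set.range (𝓡 (2 * n))) (extChartAt (𝓡 (2 * n)) p p) =
      ContinuousLinearMap.id ℝ _ := mfderivWithin_range_extChartAt_symm
  rw [modelWithCornersSelf_coe, Set.range_id, mfderivWithin_univ] at h2
  rw [inChart, h2]
  have h3 : (extChartAt (𝓡 (2 * n)) p).symm (extChartAt (𝓡 (2 * n)) p p) = p :=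
    extChartAt_to_inv p
  rw [h3, h1]
  rfl

/-- Continuity suffices later: where `dρ` vanishes, the derivative of `dρ ∘ J` involves no
derivative of `J`. -/
theorem continuousAt_inChart (J : AlmostComplexStructure n M) (p : M) :
    ContinuousAt (J.inChart p) (extChartAt (𝓡 (2 * n)) p p) := by
  have h := ((contMDiffAt_hom_bundle _).1 (J.smooth p)).2.continuousAt
  have h1 : ContinuousAt (fun y ↦ ContinuousLinearMap.inCoordinates
      (EuclideanSpace ℝ (Fin (2 * n))) (TangentSpace (𝓡 (2 * n)) (M := M))
      (EuclideanSpace ℝ (Fin (2 * n))) (TangentSpace (𝓡 (2 * n)) (M := M))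
      p ((extChartAt (𝓡 (2 * n)) p).symm y) p ((extChartAt (𝓡 (2 * n)) p).symm y)
      (J.toFun ((extChartAt (𝓡 (2 * n)) p).symm y))) (extChartAt (𝓡 (2 * n)) p p) :=
    ContinuousAt.comp_of_eq h (continuousAt_extChartAt_symm p) (by simp)
  refine h1.congr ?_
  filter_upwards [extChartAt_target_mem_nhds (I := 𝓡 (2 * n)) p] with y hy
  have hs : (extChartAt (𝓡 (2 * n)) p).symm y ∈
      (chartAt (EuclideanSpace ℝ (Fin (2 * n))) p).source := by
    simpa using (extChartAt (𝓡 (2 * n)) p).map_target hy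
  rw [ContinuousLinearMap.inCoordinates, TangentBundle.continuousLinearMapAt_trivializationAt hs,
    TangentBundle.symmL_trivializationAt hs, (extChartAt (𝓡 (2 * n)) p).right_inv hy]
  simp only [modelWithCornersSelf_coe, Set.range_id, mfderivWithin_univ]
  rfl

/-- In a chart, `d^c ρ` is `-df ∘ J`, `f` being `ρ` read in the chart. -/
theorem inChart_dc (J : AlmostComplexStructure n M) {ρ : M → ℝ} {p : M}
    (hρ : ContMDiffAt (𝓡 (2 * n)) 𝓘(ℝ, ℝ) ∞ ρ p) :
    OneForm.inChart (J.dc ρ) p =ᶠ[𝓝 (extChartAt (𝓡 (2 * n)) p p)] fun y ↦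
      -(fderiv ℝ (ρ ∘ (extChartAt (𝓡 (2 * n)) p).symm) y).comp (J.inChart p y) := by
  have h1 : ∀ᶠ q in 𝓝 p, ContMDiffAt (𝓡 (2 * n)) 𝓘(ℝ, ℝ) 1 ρ q :=
    (contMDiffAt_iff_contMDiffAt_nhds (by simp)).1 (hρ.of_le (mod_cast le_top))
  have h2 := (continuousAt_extChartAt_symm (I := 𝓡 (2 * n)) p).eventually
    (by rwa [extChartAt_to_inv])
  filter_upwards [extChartAt_target_mem_nhds (I := 𝓡 (2 * n)) p, h2] with y hy hρy
  have hs : MDifferentiableAt 𝓘(ℝ, EuclideanSpace ℝ (Fin (2 * n))) (𝓡 (2 * n))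
      (extChartAt (𝓡 (2 * n)) p).symm y := by
    have := mdifferentiableWithinAt_extChartAt_symm (I := 𝓡 (2 * n)) hy
    rwa [modelWithCornersSelf_coe, Set.range_id, mdifferentiableWithinAt_univ] at this
  have h3 := mfderiv_comp y (hρy.mdifferentiableAt (by simp)) hs
  rw [mfderiv_eq_fderiv] at h3
  -- The chart differential inside `J.inChart` cancels against that of the inverse chart from the
  -- chain rule.
  have h4 := mfderivWithin_extChartAt_symm_comp_mfderiv_extChartAt (I := 𝓡 (2 * n)) hy
  rw [modelWithCornersSelf_coe, Set.range_id, mfderivWithin_univ] at h4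
  rw [h3]
  ext u
  have h5 := DFunLike.congr_fun h4 (J.toFun ((extChartAt (𝓡 (2 * n)) p).symm y)
    (mfderiv 𝓘(ℝ, EuclideanSpace ℝ (Fin (2 * n))) (𝓡 (2 * n)) (extChartAt (𝓡 (2 * n)) p).symm y u))
  exact congrArg (fun z ↦ -(mfderiv (𝓡 (2 * n)) 𝓘(ℝ, ℝ) ρ ((extChartAt (𝓡 (2 * n)) p).symm y) z))
    h5.symm

/-- At a critical point of `ρ`, the Levi form is `v ↦ H (v, v) + H (J v, J v)`, `H` being the
Hessian. -/
theorem leviForm_eq_of_fderiv_eq_zero (J : AlmostComplexStructure n M) {ρ : M → ℝ} {p : M}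
    (hρ : ContMDiffAt (𝓡 (2 * n)) 𝓘(ℝ, ℝ) ∞ ρ p)
    (hd : fderiv ℝ (ρ ∘ (extChartAt (𝓡 (2 * n)) p).symm) (extChartAt (𝓡 (2 * n)) p p) = 0)
    (v : EuclideanSpace ℝ (Fin (2 * n))) :
    J.leviForm ρ p v =
      fderiv ℝ (fderiv ℝ (ρ ∘ (extChartAt (𝓡 (2 * n)) p).symm)) (extChartAt (𝓡 (2 * n)) p p) v v +
      fderiv ℝ (fderiv ℝ (ρ ∘ (extChartAt (𝓡 (2 * n)) p).symm)) (extChartAt (𝓡 (2 * n)) p p)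
        (J.inChart p (extChartAt (𝓡 (2 * n)) p p) v)
        (J.inChart p (extChartAt (𝓡 (2 * n)) p p) v) := by
  set f := ρ ∘ (extChartAt (𝓡 (2 * n)) p).symm with hf
  set y₀ := extChartAt (𝓡 (2 * n)) p p with hy₀
  have hfs : ContDiffAt ℝ ∞ f y₀ := hρ.contDiffAt_comp_extChartAt_symm
  have hdf : HasFDerivAt (fderiv ℝ f) (fderiv ℝ (fderiv ℝ f) y₀) y₀ :=
    (((hfs.of_le (m := 2) ENat.LEInfty.out).fderiv_right (m := 1) (by norm_num)).differentiableAt (by simp)).hasFDerivAt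
  have hα := ((hdf.clm_comp_of_eq_zero hd (J.continuousAt_inChart p)).neg).congr_of_eventuallyEq
    (J.inChart_dc hρ)
  have h1 : mfderiv (𝓡 (2 * n)) 𝓘(ℝ, EuclideanSpace ℝ (Fin (2 * n))) (extChartAt (𝓡 (2 * n)) p) p =
      ContinuousLinearMap.id ℝ _ := mfderiv_extChartAt_self
  have hKK : J.inChart p y₀ (J.inChart p y₀ v) = -v := by
    rw [hy₀, J.inChart_self]
    exact J.sq_eq_neg p v
  have hlevi : J.leviForm ρ p v =
      OneForm.extDerivAt (J.dc ρ) p v (J.inChart p y₀ v) := by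
    rw [hy₀, J.inChart_self]
    rfl
  rw [hlevi]
  unfold OneForm.extDerivAt
  rw [h1]
  -- With `w = J v`, this is `-H(v, J w) + H(w, J v)`, and `J w = -v`.
  refine (extDeriv_ofSubsingleton_apply hα v (J.inChart p y₀ v)).trans ?_
  simp [hKK]

end AlmostComplexStructure

end Levi

/-! ### Transfer to the manifold -/

section Chart

variable {n : ℕ} {M : Type*} [TopologicalSpace M] [ChartedSpace (EuclideanSpace ℝ (Fin (2 * n))) M]

/-- Local path connectedness of `{g ≥ g p}` at `p` may be checked in a chart. -/
theorem exists_nhds_joinedIn_of_chart {g : M → ℝ} {p : M}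
    (h : ∀ N ∈ 𝓝 (extChartAt (𝓡 (2 * n)) p p),
      (∃ z ∈ N, g p < g ((extChartAt (𝓡 (2 * n)) p).symm z)) ∧
      ∃ V ∈ 𝓝 (extChartAt (𝓡 (2 * n)) p p), ∀ x ∈ V, ∀ y ∈ V,
        g p ≤ g ((extChartAt (𝓡 (2 * n)) p).symm x) →
        g p ≤ g ((extChartAt (𝓡 (2 * n)) p).symm y) →
        JoinedIn ({x, y} ∪ (N ∩ {z | g p < g ((extChartAt (𝓡 (2 * n)) p).symm z)})) x y)
    {N : Set M} (hN : N ∈ 𝓝 p) :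
    (∃ z ∈ N, g p < g z) ∧
    ∃ V ∈ 𝓝 p, ∀ x ∈ V, ∀ y ∈ V, g p ≤ g x → g p ≤ g y →
      JoinedIn ({x, y} ∪ (N ∩ {z | g p < g z})) x y := by
  set φ := extChartAt (𝓡 (2 * n)) p with hφ
  -- Intersecting with the chart target makes `φ.symm` continuous along the paths to be transported.
  have hN' : φ.symm ⁻¹' N ∩ φ.target ∈ 𝓝 (φ p) := Filter.inter_mem
    ((continuousAt_extChartAt_symm p).preimage_mem_nhds (by rwa [extChartAt_to_inv]))
    (extChartAt_target_mem_nhds p)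
  obtain ⟨⟨z, hz, hgz⟩, V, hV, hVj⟩ := h _ hN'
  refine ⟨⟨φ.symm z, hz.1, hgz⟩, φ ⁻¹' V ∩ φ.source, Filter.inter_mem
    ((continuousAt_extChartAt p).preimage_mem_nhds hV) (extChartAt_source_mem_nhds p), ?_⟩
  intro x hx y hy hgx hgy
  have hx' := φ.left_inv hx.2
  have hy' := φ.left_inv hy.2
  have hj := hVj (φ x) hx.1 (φ y) hy.1 (by rwa [hx']) (by rwa [hy'])
  have hcont : ContinuousOn φ.symm
      ({φ x, φ y} ∪ (φ.symm ⁻¹' N ∩ φ.target ∩ {z | g p < g (φ.symm z)})) := by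
    refine (continuousOn_extChartAt_symm p).mono ?_
    rintro z ((rfl | rfl) | hz)
    · exact φ.map_source hx.2
    · exact φ.map_source hy.2
    · exact hz.1.2
  have hm := hj.map_continuousOn hcont
  rw [hx', hy'] at hm
  refine hm.mono ?_
  rintro _ ⟨z, (rfl | rfl) | hz, rfl⟩
  · left; left; exact hx'
  · left; right; exact hy'
  · exact Or.inr ⟨hz.1.1, hz.2⟩

theorem mfderiv_eq_fderiv_comp_extChartAt_symm {g : M → ℝ} {p : M}
    (hg : ContMDiffAt (𝓡 (2 * n)) 𝓘(ℝ, ℝ) ∞ g p) :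
    mfderiv (𝓡 (2 * n)) 𝓘(ℝ, ℝ) g p =
      fderiv ℝ (g ∘ (extChartAt (𝓡 (2 * n)) p).symm) (extChartAt (𝓡 (2 * n)) p p) := by
  rw [(hg.mdifferentiableAt (by simp)).mfderiv]
  simp only [modelWithCornersSelf_coe, Set.range_id, fderivWithin_univ]
  rfl

/-- Near a regular point `p` of `g`, the set `{g ≥ g p}` is locally path connected. -/
theorem exists_nhds_joinedIn_of_mfderiv_ne_zero {g : M → ℝ} {p : M}
    (hg : ContMDiffAt (𝓡 (2 * n)) 𝓘(ℝ, ℝ) ∞ g p) (hd : mfderiv (𝓡 (2 * n)) 𝓘(ℝ, ℝ) g p ≠ 0)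
    {N : Set M} (hN : N ∈ 𝓝 p) :
    (∃ z ∈ N, g p < g z) ∧
    ∃ V ∈ 𝓝 p, ∀ x ∈ V, ∀ y ∈ V, g p ≤ g x → g p ≤ g y →
      JoinedIn ({x, y} ∪ (N ∩ {z | g p < g z})) x y := by
  refine exists_nhds_joinedIn_of_chart (n := n) (fun N' hN' ↦ ?_) hN
  rw [mfderiv_eq_fderiv_comp_extChartAt_symm hg] at hd
  have := exists_nhds_joinedIn_of_fderiv_ne_zero
    (hg.contDiffAt_comp_extChartAt_symm.of_le (mod_cast le_top)) hd hN'
  simpa only [Function.comp_apply, extChartAt_to_inv] using this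

/-- Near any point `p` at which the Levi form of `ρ` is positive, `{ρ ≥ ρ p}` is locally path
connected and `p` is not a local maximum. -/
theorem AlmostComplexStructure.exists_nhds_joinedIn_of_leviForm_pos
    [IsManifold (𝓡 (2 * n)) ∞ M] (hn : 2 ≤ n)
    (J : AlmostComplexStructure n M) {ρ : M → ℝ} {p : M}
    (hρ : ContMDiffAt (𝓡 (2 * n)) 𝓘(ℝ, ℝ) ∞ ρ p)
    (hL : ∀ v : TangentSpace (𝓡 (2 * n)) p, v ≠ 0 → 0 < J.leviForm ρ p v)
    {N : Set M} (hN : N ∈ 𝓝 p) :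
    (∃ z ∈ N, ρ p < ρ z) ∧
    ∃ V ∈ 𝓝 p, ∀ x ∈ V, ∀ y ∈ V, ρ p ≤ ρ x → ρ p ≤ ρ y →
      JoinedIn ({x, y} ∪ (N ∩ {z | ρ p < ρ z})) x y := by
  by_cases hd : mfderiv (𝓡 (2 * n)) 𝓘(ℝ, ℝ) ρ p = 0
  · refine exists_nhds_joinedIn_of_chart (n := n) (fun N' hN' ↦ ?_) hN
    rw [mfderiv_eq_fderiv_comp_extChartAt_symm hρ] at hd
    obtain ⟨v, w, hvw⟩ := exists_plane_pos_of_add_pos (by rw [finrank_euclideanSpace_fin]; omega)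
      (fderiv ℝ (fderiv ℝ (ρ ∘ (extChartAt (𝓡 (2 * n)) p).symm)) (extChartAt (𝓡 (2 * n)) p p))
      (J.inChart p (extChartAt (𝓡 (2 * n)) p p)) fun v hv ↦ by
        rw [← J.leviForm_eq_of_fderiv_eq_zero hρ hd]
        exact hL v hv
    have := exists_nhds_joinedIn_of_hessian_pos
      (hρ.contDiffAt_comp_extChartAt_symm.of_le ENat.LEInfty.out) hd hvw hN'
    simpa only [Function.comp_apply, extChartAt_to_inv] using this
  · exact exists_nhds_joinedIn_of_mfderiv_ne_zero hρ hd hN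

end Chart

/-! ### The boundary of the region -/

theorem proposition2p1 (n : ℕ) (hn : 2 ≤ n) (M : Type*) [TopologicalSpace M] [T2Space M]
    [SecondCountableTopology M] [ChartedSpace (EuclideanSpace ℝ (Fin (2 * n))) M]
    [IsManifold (𝓡 (2 * n)) ∞ M] (J : AlmostComplexStructure n M) (D : Set M)
    (hD : J.IsStronglyPseudoconvexRegion D) (hcomp : IsCompact (closure D)) :
    IsConnected (frontier D) := by
  obtain ⟨hDo, hDc, U, ρ, hU, hDU, hρ, hDρ, hreg, hpsh⟩ := hD
  have hρat : ∀ p ∈ closure D, ContMDiffAt (𝓡 (2 * n)) 𝓘(ℝ, ℝ) ∞ ρ p := fun p hp ↦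
    hρ.contMDiffAt (hU.mem_nhds (hDU hp))
  have hDmem : ∀ p, p ∈ D ↔ p ∈ U ∧ ρ p < 0 := fun p ↦ by
    conv_lhs => rw [hDρ]
    rfl
  have hle : ∀ p ∈ closure D, ρ p ≤ 0 := by
    intro p hp
    by_contra! hlt
    obtain ⟨q, hq, hqD⟩ := mem_closure_iff_nhds.1 hp _
      ((hρat p hp).continuousAt.eventually (lt_mem_nhds hlt))
    exact lt_asymm (show 0 < ρ q from hq) ((hDmem q).1 hqD).2
  have hfr : frontier D = closure D ∩ {p | ρ p = 0} := by
    rw [frontier, hDo.interior_eq]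
    ext p
    refine and_congr_right fun hp ↦ ?_
    rw [hDmem]
    refine ⟨fun h ↦ le_antisymm (hle p hp) (not_lt.1 fun h' ↦ h ⟨hDU hp, h'⟩), fun h h' ↦ ?_⟩
    exact h'.2.ne h
  rw [hfr]
  refine isConnected_setOf_eq_zero_of_local_joinedIn hcomp hDc.closure
    (fun p hp ↦ (hρat p hp).continuousAt.continuousWithinAt) hle fun c hc p hp hcp ↦ ?_
  -- Plurisubharmonicity matters only when `ρ p = c`, and then `p` lies in `D` because `c < 0`. When
  -- `ρ p > c`, only the local shape of `closure D` counts.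
  rcases hcp.eq_or_lt with rfl | hlt
  · have hpD : p ∈ D := (hDmem p).2 ⟨hDU hp, hc⟩
    have hloc := fun (N : Set M) (hN : N ∈ 𝓝 p) ↦
      J.exists_nhds_joinedIn_of_leviForm_pos hn (hρat p hp) (hpsh p (hDU hp)) hN
    constructor
    · rw [mem_closure_iff_nhds]
      intro N hN
      obtain ⟨z, hz, hρz⟩ := (hloc _ (Filter.inter_mem hN (hDo.mem_nhds hpD))).1
      exact ⟨z, hz.1, subset_closure hz.2, hρz⟩
    · obtain ⟨V, hV, hVj⟩ := (hloc D (hDo.mem_nhds hpD)).2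
      refine ⟨V, hV, fun x hx y hy hxS hyS ↦
        (hVj x hx y hy (le_of_lt hxS.2) (le_of_lt hyS.2)).mono ?_⟩
      rintro z ((rfl | rfl) | hz)
      · exact hxS
      · exact hyS
      · exact ⟨subset_closure hz.1, hz.2⟩
  · refine ⟨subset_closure ⟨hp, hlt⟩, ?_⟩
    have hN : {z | c < ρ z} ∈ 𝓝 p := (hρat p hp).continuousAt.eventually (lt_mem_nhds hlt)
    by_cases hpD : p ∈ D
    · have : LocallyPathConnectedSpace M :=
        ChartedSpace.locallyPathConnectedSpace (EuclideanSpace ℝ (Fin (2 * n))) M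
      obtain ⟨V, ⟨hV, hVp⟩, hVN⟩ := (path_connected_basis p).mem_iff.1
        (Filter.inter_mem (hDo.mem_nhds hpD) hN)
      exact ⟨V, hV, fun x hx y hy _ _ ↦ (hVp.joinedIn x hx y hy).mono fun z hz ↦
        ⟨subset_closure (hVN hz).1, (hVN hz).2⟩⟩
    · have hpf : p ∈ frontier D := by
        rw [frontier, hDo.interior_eq]
        exact ⟨hp, hpD⟩
      have hp0 : ρ p = 0 := (hfr ▸ hpf).2
      -- At a boundary point `closure D` lies in `{-ρ ≥ 0}` and `-ρ` is regular, so nearby points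
      -- are joined through `{-ρ > 0}`, that is, through `D`.
      have hd : mfderiv (𝓡 (2 * n)) 𝓘(ℝ, ℝ) (fun q ↦ -ρ q) p ≠ 0 := by
        intro h
        have hneg : mfderiv (𝓡 (2 * n)) 𝓘(ℝ, ℝ) (fun q ↦ -ρ q) p =
          -mfderiv (𝓡 (2 * n)) 𝓘(ℝ, ℝ) ρ p := mfderiv_neg
        exact hreg p hpf (neg_eq_zero.1 (hneg.symm.trans h))
      obtain ⟨V, hV, hVj⟩ := (exists_nhds_joinedIn_of_mfderiv_ne_zero (hρat p hp).neg hd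
        (Filter.inter_mem (hU.mem_nhds (hDU hp)) hN)).2
      refine ⟨V, hV, fun x hx y hy hxS hyS ↦ (hVj x hx y hy ?_ ?_).mono ?_⟩
      · simpa [hp0] using hle x hxS.1
      · simpa [hp0] using hle y hyS.1
      · rintro z ((rfl | rfl) | hz)
        · exact hxS
        · exact hyS
        · refine ⟨subset_closure ((hDmem z).2 ⟨hz.1.1, ?_⟩), hz.1.2⟩
          simpa [hp0] using hz.2
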